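/- **Setting.** A (self-similar) non-autonomous IFS on $\mathbb{R}$ with invariant set $X$ is a sequence $(\Phi_n)_{n\ge 1}$, $\Phi_n=\{S_{n,j}\}_{j\in\mathcal J_n}$ with $2\le\#\mathcal J_n<\infty$, of similarities $S_{n,j}(x)=r_{n,j}O_{n,j}x+d_{n,j}$ with $r_{n,j}\in(0,1)$, $O_{n,j}\in\{1,-1\}$ and $d_{n,j}\in\mathbb R$, together with a non-empty compact set $X\subset\mathbb R$ such that $S_{n,j}(X)\subset X$ for all $n,j$, and such that $\max\{r_{1,j_1}\cdots r_{n,j_n}: j_i\in\mathcal J_i\}\to 0$ as $n\to\infty$. It is *homogeneous* if for each $n$ the ratios $r_{n,j}$, $j\in\mathcal J_n$, all coincide, and *inhomogeneous* otherwise. Its limit set is $$K=\bigcap_{n\ge 1}\ \bigcup_{(j_1,\dots,j_n)\in\mathcal J_1\times\cdots\times\mathcal J_n}S_{1,j_1}\circ\cdots\circ S_{n,j_n}(X).$$ Let $\Delta=\prod_{n\ge1}\mathcal J_n$, and let $\pi:\Delta\to K$ be the coding map, $\{\pi((i_n)_n)\}=\bigcap_n S_{1,i_1}\circ\cdots\circ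 S_{n,i_n}(X)$. For a cylinder $Q=[j_1,\dots,j_n]\subset\Delta$ put $\rho(Q)=r_{1,j_1}\cdots r_{n,j_n}$ (so $\rho(\Delta)=1$), and for $n\ge 1$ let $\widehat Q=[j_1,\dots,j_{n-1}]$ be its parent. For $r>0$ let $\mathcal T(r)$ be the set of cylinders $Q\ne\Delta$ with $\rho(Q)\le r<\rho(\widehat Q)$, and put $$M(r)=\sup_{x\in K}\#\{Q\in\mathcal T(r):\pi(Q)\cap B(x,r)\ne\varnothing\},$$ where $B(x,r)$ is the closed ball. The *open set condition* (with respect to $U=X^\circ$) says that $U\neq\varnothing$ and $S_{n,j}(U)\cap S_{n,j'}(U)=\varnothing$ for all $n$ and all $j\ne j'$ in $\mathcal J_n$; the *cone condition* says that $\inf_{x\in X}\inf_{r\in(0,1)}r^{-1}\mathcal L^1(B(x,r)\cap U)>0$, where $\mathcal L^1$ is Lebesgue measure. For $n,m\ge1$, $\theta(n,m)$ is the unique real zero of $$\phi_{n,m}(t)=\frac1m\log\sum_{j_0\in\mathcal J_n}\cdots\sum_{j_{m-1}\in\mathcal J_{n+m-1}}\ \prod_{k=0}^{m-1}r_{n+k,j_k}^{\,t}.$$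 Finally, $\dim_A K$ is the infimum of all real $s$ for which there is $C>0$ such that, for all $0<r\le R<1$ and all $x\in K$, the set $B(x,R)\cap K$ can be covered by at most $C(R/r)^s$ closed balls of radius $r$. **Statement.** Let $\varepsilon>0$ and let $f$ be a real-valued function with $f(r)\to\infty$ as $r\to0^+$. Then there is an inhomogeneous non-autonomous IFS on $\mathbb R$ with invariant set $X=[0,1]$ which 1. satisfies the open set condition and the cone condition, with respect to $U=(0,1)$; 2. has $M(r)\le f(r)$ for all sufficiently small $r>0$; 3. has $\#\mathcal J_n=2$ for all $n\ge1$; 4. has $\dim_A K=1$; and 5. has $0<\theta(n,m)\le\varepsilon$ for all $n,m\ge1$. -/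

import Mathlib

open Filter Topology MeasureTheory
open scoped ENNReal

/-- A non-autonomous iterated function system of similarities
`x ↦ ratio n j • orth n j x + trans n j` on a Euclidean space `E`, together with its invariant
compact set `X`. Levels are indexed from `0`: the index set `J n` here is the one that is called
`𝒥_{n+1}` when levels are counted from `1`. -/
structure NonautonomousIFS (E : Type*) [NormedAddCommGroup E] [InnerProductSpace ℝ E] where
  J : ℕ → Type
  fintypeJ : ∀ n, Fintype (J n)
  two_le_card : ∀ n, 2 ≤ Fintype.card (J n)
  ratio : ∀ n, J n → ℝ
  ratio_pos : ∀ n j, 0 < ratio n j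
  ratio_lt_one : ∀ n j, ratio n j < 1
  orth : ∀ n, J n → (E ≃ₗᵢ[ℝ] E)
  trans : ∀ n, J n → E
  X : Set E
  nonempty_X : X.Nonempty
  isCompact_X : IsCompact X
  mapsTo_X : ∀ n j, Set.MapsTo (fun x => ratio n j • orth n j x + trans n j) X X
  /-- The largest product of ratios over words of length `n` tends to `0`
  (words of length `n` are the initial segments of infinite words). -/
  tendsto_iSup_ratio :
    Tendsto (fun n => ⨆ ω : (∀ k, J k), ∏ i ∈ Finset.range n, ratio i (ω i)) atTop (𝓝 0)

namespace NonautonomousIFS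

variable {E : Type*} [NormedAddCommGroup E] [InnerProductSpace ℝ E] (Φ : NonautonomousIFS E)

instance (n : ℕ) : Fintype (Φ.J n) := Φ.fintypeJ n

/-- The similarity map `S_{n,j}`. -/
def map (n : ℕ) (j : Φ.J n) : E → E := fun x => Φ.ratio n j • Φ.orth n j x + Φ.trans n j

/-- The symbolic space `Δ` of infinite words. -/
abbrev Δ : Type := ∀ n, Φ.J n

/-- The composition of the maps given by the first `n` letters of `ω`,
`S_{0,ω 0} ∘ ⋯ ∘ S_{n-1,ω (n-1)}`. -/
def comp (ω : Φ.Δ) : ℕ → E → E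
  | 0 => id
  | n + 1 => comp ω n ∘ Φ.map n (ω n)

/-- The limit set: the intersection over all levels of the unions of the level-`n` cylinders. -/
def limitSet : Set E := ⋂ n : ℕ, ⋃ ω : Φ.Δ, Φ.comp ω n '' Φ.X

/-- The contraction ratio of the composition given by the first `n` letters of `ω`. -/
def rho (ω : Φ.Δ) (n : ℕ) : ℝ := ∏ i ∈ Finset.range n, Φ.ratio i (ω i)

/-- The cylinder `[ω 0, …, ω (n-1)]`. -/
def cyl (ω : Φ.Δ) (n : ℕ) : Set Φ.Δ := {ω' | ∀ i < n, ω' i = ω i}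

/-- The cylinders of size `r`: `ρ(Q) ≤ r < ρ(Q̂)`, where `Q̂` is the parent of `Q`.
Since every index set has at least two elements, a cylinder determines its level and its word,
so that `ρ(Q)` and `Q̂` are well defined. -/
def cylindersOfSize (r : ℝ) : Set (Set Φ.Δ) :=
  {Q | ∃ (ω : Φ.Δ) (n : ℕ), Q = Φ.cyl ω (n + 1) ∧ Φ.rho ω (n + 1) ≤ r ∧ r < Φ.rho ω n}

theorem instNonemptyJ (n : ℕ) : Nonempty (Φ.J n) :=
  Fintype.card_pos_iff.mp (lt_of_lt_of_le (by norm_num) (Φ.two_le_card n))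

theorem rho_pos (ω : Φ.Δ) (n : ℕ) : 0 < Φ.rho ω n :=
  Finset.prod_pos fun i _ => Φ.ratio_pos i _

theorem rho_le_one (ω : Φ.Δ) (n : ℕ) : Φ.rho ω n ≤ 1 :=
  Finset.prod_le_one (fun i _ => (Φ.ratio_pos i _).le) fun i _ => (Φ.ratio_lt_one i _).le

theorem tendsto_rho (ω : Φ.Δ) : Tendsto (Φ.rho ω) atTop (𝓝 0) := by
  refine squeeze_zero (fun n => (Φ.rho_pos ω n).le) (fun n => ?_) Φ.tendsto_iSup_ratio
  exact le_ciSup (f := fun ω : Φ.Δ => Φ.rho ω n)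
    ⟨1, by rintro _ ⟨ω', rfl⟩; exact Φ.rho_le_one ω' n⟩ ω

theorem dist_map (n : ℕ) (j : Φ.J n) (x y : E) :
    dist (Φ.map n j x) (Φ.map n j y) = Φ.ratio n j * dist x y := by
  simp only [map, dist_add_right, dist_smul₀, LinearIsometryEquiv.dist_map, Real.norm_eq_abs,
    abs_of_pos (Φ.ratio_pos n j)]

theorem dist_comp (ω : Φ.Δ) (n : ℕ) (x y : E) :
    dist (Φ.comp ω n x) (Φ.comp ω n y) = Φ.rho ω n * dist x y := by
  induction n generalizing x y with
  | zero => simp [comp, rho]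
  | succ n ih =>
    simp only [comp, Function.comp_apply, ih, dist_map, rho, Finset.prod_range_succ]
    ring

theorem continuous_comp (ω : Φ.Δ) (n : ℕ) : Continuous (Φ.comp ω n) := by
  refine LipschitzWith.continuous (K := 1) (LipschitzWith.of_dist_le_mul fun x y => ?_)
  rw [dist_comp]
  exact mul_le_mul_of_nonneg_right (by simpa using Φ.rho_le_one ω n) dist_nonneg

theorem existsUnique_coding (ω : Φ.Δ) : ∃! x : E, ∀ n, x ∈ Φ.comp ω n '' Φ.X := by
  obtain ⟨x, hx⟩ := IsCompact.nonempty_iInter_of_sequence_nonempty_isCompact_isClosed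
    (fun n => Φ.comp ω n '' Φ.X)
    (fun n => by
      rintro _ ⟨y, hy, rfl⟩
      exact ⟨Φ.map n (ω n) y, Φ.mapsTo_X n (ω n) hy, rfl⟩)
    (fun n => Φ.nonempty_X.image _)
    (Φ.isCompact_X.image (Φ.continuous_comp ω 0))
    (fun n => (Φ.isCompact_X.image (Φ.continuous_comp ω n)).isClosed)
  refine ⟨x, fun n => Set.mem_iInter.mp hx n, fun y hy => ?_⟩
  have key : ∀ n, dist y x ≤ Φ.rho ω n * Metric.diam Φ.X := fun n => by
    obtain ⟨a, ha, hay⟩ := hy n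
    obtain ⟨b, hb, hbx⟩ := Set.mem_iInter.mp hx n
    rw [← hay, ← hbx, dist_comp]
    exact mul_le_mul_of_nonneg_left (Metric.dist_le_diam_of_mem Φ.isCompact_X.isBounded ha hb)
      (Φ.rho_pos ω n).le
  have h0 : Tendsto (fun n => Φ.rho ω n * Metric.diam Φ.X) atTop (𝓝 0) := by
    simpa using (Φ.tendsto_rho ω).mul_const (Metric.diam Φ.X)
  exact dist_le_zero.mp (ge_of_tendsto' h0 key)

/-- The coding map `π : Δ → E`, with `{π ω} = ⋂ n, S_{0,ω 0} ∘ ⋯ ∘ S_{n-1,ω (n-1)} (X)`. -/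
noncomputable def coding (ω : Φ.Δ) : E := (Φ.existsUnique_coding ω).choose

theorem coding_mem (ω : Φ.Δ) (n : ℕ) : Φ.coding ω ∈ Φ.comp ω n '' Φ.X :=
  (Φ.existsUnique_coding ω).choose_spec.1 n

/-- The neighbourhood `𝒩(x, r)`: cylinders of size `r` whose image meets the ball `B(x, r)`. -/
def neighbourhood (x : E) (r : ℝ) : Set (Set Φ.Δ) :=
  {Q | Q ∈ Φ.cylindersOfSize r ∧ (Φ.coding '' Q ∩ Metric.closedBall x r).Nonempty}

/-- The neighbourhood count `M(r)`, the supremum over `x ∈ K` of `#𝒩(x, r)`. -/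
noncomputable def neighbourhoodCount (r : ℝ) : ℕ∞ :=
  ⨆ x ∈ Φ.limitSet, (Φ.neighbourhood x r).encard

/-- The open set condition, with the interior of `X` as the open set. -/
def OpenSetCondition : Prop :=
  (interior Φ.X).Nonempty ∧
    ∀ n, ∀ j j' : Φ.J n, j ≠ j' →
      Φ.map n j '' interior Φ.X ∩ Φ.map n j' '' interior Φ.X = ∅

/-- The cone condition: the infimum over `x ∈ X` and `r ∈ (0,1)` of
`r^{-d} ℒ^d(B(x,r) ∩ interior X)` is positive, where `d = dim E`. -/
def ConeCondition [MeasureSpace E] : Prop :=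
  0 < ⨅ x ∈ Φ.X, ⨅ r ∈ Set.Ioo (0 : ℝ) 1,
    (ENNReal.ofReal r)⁻¹ ^ Module.finrank ℝ E * volume (Metric.closedBall x r ∩ interior Φ.X)

/-- At every level all contraction ratios agree. -/
def Homogeneous : Prop := ∀ n, ∃ r : ℝ, ∀ j, Φ.ratio n j = r

/-- The pressure function of the `m` levels starting at level `n`. -/
noncomputable def pressure (n m : ℕ) (t : ℝ) : ℝ :=
  1 / (m : ℝ) * Real.log
    (∑ w : (∀ k : Fin m, Φ.J (n + k)), ∏ k : Fin m, Φ.ratio (n + k) (w k) ^ t)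

theorem existsUnique_pressure_eq_zero (n m : ℕ) (hm : 0 < m) :
    ∃! t : ℝ, Φ.pressure n m t = 0 := by
  have hne : ∀ n, Nonempty (Φ.J n) := Φ.instNonemptyJ
  let W := ∀ k : Fin m, Φ.J (n + k)
  let p : W → ℝ := fun w => ∏ k : Fin m, Φ.ratio (n + k) (w k)
  have hp0 : ∀ w, 0 < p w := fun w => Finset.prod_pos fun k _ => Φ.ratio_pos _ _
  have hp1 : ∀ w, p w < 1 := fun w => by
    have h := Finset.prod_lt_prod_of_nonempty (s := (Finset.univ : Finset (Fin m)))
      (f := fun k : Fin m => Φ.ratio (n + k) (w k)) (g := fun _ => (1 : ℝ))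
      (fun k _ => Φ.ratio_pos _ _) (fun k _ => Φ.ratio_lt_one _ _) ⟨⟨0, hm⟩, Finset.mem_univ _⟩
    simpa [p] using h
  let F : ℝ → ℝ := fun t => ∑ w : W, p w ^ t
  have hPF : ∀ t, Φ.pressure n m t = 1 / (m : ℝ) * Real.log (F t) := fun t => by
    have : ∀ w : W, ∏ k : Fin m, Φ.ratio (n + k) (w k) ^ t = p w ^ t := fun w =>
      Real.finsetProd_rpow _ _ (fun k _ => (Φ.ratio_pos _ _).le) t
    simp only [pressure, F]
    rw [Finset.sum_congr rfl fun w _ => this w]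
  have hF0 : ∀ t, 0 < F t := fun t =>
    Finset.sum_pos (fun w _ => Real.rpow_pos_of_pos (hp0 w) t) Finset.univ_nonempty
  have hanti : StrictAnti F := fun s t hst =>
    Finset.sum_lt_sum_of_nonempty Finset.univ_nonempty fun w _ =>
      Real.rpow_lt_rpow_of_exponent_gt (hp0 w) (hp1 w) hst
  have hcont : Continuous F := continuous_finsetSum _ fun w _ =>
    Real.continuous_const_rpow (hp0 w).ne'
  have hlim : Tendsto F atTop (𝓝 0) := by
    have h := tendsto_finsetSum (Finset.univ : Finset W) fun w _ =>
      tendsto_rpow_atTop_of_base_lt_one (p w) (by linarith [hp0 w]) (hp1 w)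
    simpa [F] using h
  have h1 : (1 : ℝ) ≤ F 0 := by
    simp only [F, Real.rpow_zero, Finset.sum_const, nsmul_eq_mul, mul_one]
    exact_mod_cast Finset.card_pos.mpr (Finset.univ_nonempty (α := W))
  obtain ⟨b, hb⟩ := (hlim.eventually (gt_mem_nhds (zero_lt_one))).exists
  obtain ⟨t, ht⟩ := mem_range_of_exists_le_of_exists_ge hcont ⟨b, hb.le⟩ ⟨0, h1⟩
  refine ⟨t, ?_, fun s hs => ?_⟩
  · change Φ.pressure n m t = 0
    rw [hPF, ht, Real.log_one, mul_zero]
  · have hm' : (1 / (m : ℝ)) ≠ 0 := by positivity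
    replace hs : Φ.pressure n m s = 0 := hs
    rw [hPF] at hs
    have hlog := (mul_eq_zero.mp hs).resolve_left hm'
    have hFs : F s = 1 := Real.eq_one_of_pos_of_log_eq_zero (hF0 s) hlog
    exact hanti.injective (hFs.trans ht.symm)

/-- `θ(n, m)`, the unique zero of the pressure function. -/
noncomputable def theta (n m : ℕ) (hm : 0 < m) : ℝ :=
  (Φ.existsUnique_pressure_eq_zero n m hm).choose

theorem pressure_theta (n m : ℕ) (hm : 0 < m) : Φ.pressure n m (Φ.theta n m hm) = 0 :=
  (Φ.existsUnique_pressure_eq_zero n m hm).choose_spec.1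

end NonautonomousIFS

/-- The Assouad dimension of a set `K`; the covering numbers count closed balls of radius `r`
with arbitrary centres. -/
noncomputable def assouadDim {Y : Type*} [PseudoMetricSpace Y] (K : Set Y) : EReal :=
  sInf ((fun s : ℝ => (s : EReal)) '' {s : ℝ | ∃ C : ℝ, 0 < C ∧
    ∀ r R : ℝ, 0 < r → r ≤ R → R < 1 → ∀ x ∈ K,
      (Metric.externalCoveringNumber r.toNNReal (Metric.closedBall x R ∩ K) : ℝ≥0∞)
        ≤ ENNReal.ofReal (C * (R / r) ^ s)})

/-!
The system has at level `n` the maps `x ↦ a n * x` and `x ↦ b n * x + (1 - b n)` of `[0, 1]`, where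
`a n = 1 - 1 / (h n + 3)` for a non-decreasing sequence `h n ≤ n` of natural numbers that tends to
infinity very slowly, and `b n` is so small that `(a n) ^ ε + (b n) ^ ε ≤ 1`. The sums in the
pressure are products over the levels of `(a n) ^ t + (b n) ^ t`, which exceeds `1` for `t ≤ 0`
and less than `1` for `t > ε`, so all zeros of the pressure lie in `(0, ε]`.

The limit set contains the products `u k = a 0 * ⋯ * a (k - 1)`, which tend to `0` while
`u (k + 1) / u k` tends to `1`. Seen from the scale `u k`, the points `u j` with `j ≥ k` are nearly
dense in `[0, u k]`, and so the Assouad dimension is `1` (`one_le_assouadDim_of_seq`).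

For the neighbourhood count, let `Q` be a cylinder of size `r` and `S` the map of its parent, at
level `n`. Assign to `Q` the cell `S [0, a n)` or `S [a n, 1)` according to its last letter; in the
second case this adds to the tiny image of `Q` the gap on its left. The cells of distinct cylinders
of size `r` are disjoint (`TwoMapRatios.cells_disjoint`), and their lengths are at least
`r / (h n + 3)`, so a ball of radius `r` meets at most `2 * h n + 8` of them
(`TwoMapRatios.neighbourhoodCount_le`), where `n` is the last level reached by parents of cylinders
of size `r`. As `a 0 * ⋯ * a (n - 1) ≤ 2 / (n + 2)`, this level is at most about `2 / r`, whatever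
`h` is, and `h` can be chosen after `f` (`exists_slow_sequence`).
-/

open NonautonomousIFS

/-! ### Counting disjoint intervals -/

/-- At most `m + 2` pairwise disjoint intervals `[lo, hi)` of length at least `d` have a closure
meeting `[y, z]`, when `[y, z]` has length at most `m * d`. -/
theorem encard_le_of_disjoint_intervals {α : Type*} (S : Set α) (lo hi : α → ℝ) (y z d : ℝ)
    (m : ℕ) (hd : 0 < d) (hyz : y ≤ z) (hm : z - y ≤ m * d)
    (hlen : ∀ q ∈ S, lo q + d ≤ hi q) (hhi : ∀ q ∈ S, y ≤ hi q) (hlo : ∀ q ∈ S, lo q ≤ z)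
    (hdisj : ∀ q ∈ S, ∀ q' ∈ S, q ≠ q' → hi q ≤ lo q' ∨ hi q' ≤ lo q) :
    S.encard ≤ (m + 2 : ℕ) := by
  -- `[p q, p q + d)` is a subinterval of `[lo q, hi q)` starting in `[y - d, z]`.
  set p : α → ℝ := fun q => max (lo q) (y - d) with hp
  have hp_hi : ∀ q ∈ S, p q + d ≤ hi q := fun q hq => by
    have := hlen q hq
    have := hhi q hq
    rcases max_cases (lo q) (y - d) with h | h <;> simp only [hp, h.1] <;> linarith
  have hsep : ∀ q ∈ S, ∀ q' ∈ S, hi q ≤ lo q' →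
      (p q - (y - d)) / d + 1 ≤ (p q' - (y - d)) / d := fun q hq q' hq' h => by
    have h1 := hp_hi q hq
    have h2 : lo q' ≤ p q' := le_max_left _ _
    rw [div_add_one hd.ne']
    gcongr
    linarith
  have h0 : ∀ q, 0 ≤ (p q - (y - d)) / d := fun q =>
    div_nonneg (sub_nonneg.mpr (le_max_right _ _)) hd.le
  set g : α → ℕ := fun q => ⌊(p q - (y - d)) / d⌋₊ with hg
  have hmaps : Set.MapsTo g S (Finset.range (m + 2) : Set ℕ) := fun q hq => by
    simp only [Finset.coe_range, Set.mem_Iio, hg]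
    rw [Nat.floor_lt (h0 q), div_lt_iff₀ hd]
    have : p q ≤ z := max_le (hlo q hq) (by linarith)
    push_cast
    linarith
  have hinj : Set.InjOn g S := fun q hq q' hq' h => by
    by_contra hne
    have e1 := Nat.floor_le (h0 q)
    have e2 := Nat.lt_floor_add_one ((p q - (y - d)) / d)
    have e3 := Nat.floor_le (h0 q')
    have e4 := Nat.lt_floor_add_one ((p q' - (y - d)) / d)
    have h' : (⌊(p q - (y - d)) / d⌋₊ : ℝ) = ⌊(p q' - (y - d)) / d⌋₊ := by exact_mod_cast h
    rcases hdisj q hq q' hq' hne with h1 | h1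
    · linarith [hsep q hq q' hq' h1]
    · linarith [hsep q' hq' q hq h1]
  calc S.encard ≤ (Finset.range (m + 2) : Set ℕ).encard :=
        Set.encard_le_encard_of_injOn hmaps hinj
    _ = (m + 2 : ℕ) := by rw [Set.encard_coe_eq_coe_finsetCard, Finset.card_range]

/-! ### Systems of two maps fixing the two ends of the unit interval -/

/-- The contraction ratios of a system which at level `n` consists of the maps `x ↦ long n * x`
and `x ↦ short n * x + (1 - short n)` of the unit interval. -/
structure TwoMapRatios where
  long : ℕ → ℝ
  short : ℕ → ℝ
  half_lt_long : ∀ n, 1 / 2 < long n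
  short_pos : ∀ n, 0 < short n
  long_add_short_le : ∀ n, long n + short n ≤ 1
  tendsto_prod_long : Tendsto (fun n => ∏ i ∈ Finset.range n, long i) atTop (𝓝 0)

namespace TwoMapRatios

variable (D : TwoMapRatios)

theorem long_pos (n : ℕ) : 0 < D.long n := by linarith [D.half_lt_long n]

theorem long_lt_one (n : ℕ) : D.long n < 1 := by
  linarith [D.long_add_short_le n, D.short_pos n]

theorem short_lt_long (n : ℕ) : D.short n < D.long n := by
  linarith [D.long_add_short_le n, D.half_lt_long n]

/-- The ratio of the map with a given letter: `true` stands for the short map. -/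
def ratio (n : ℕ) (j : Bool) : ℝ := if j then D.short n else D.long n

/-- The image of `0` under the map with a given letter. -/
def trans (n : ℕ) (j : Bool) : ℝ := if j then 1 - D.short n else 0

theorem ratio_pos (n : ℕ) (j : Bool) : 0 < D.ratio n j := by
  cases j
  · exact D.long_pos n
  · exact D.short_pos n

theorem ratio_le_long (n : ℕ) (j : Bool) : D.ratio n j ≤ D.long n := by
  cases j
  · exact le_rfl
  · exact (D.short_lt_long n).le

theorem trans_nonneg (n : ℕ) (j : Bool) : 0 ≤ D.trans n j := by
  have := D.short_lt_long n
  have := D.long_lt_one n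
  cases j <;> simp [trans]
  linarith

theorem trans_add_ratio_le (n : ℕ) (j : Bool) : D.trans n j + D.ratio n j ≤ 1 := by
  cases j <;> simp [trans, ratio]
  exact (D.long_lt_one n).le

theorem prod_ratio_le (ω : ℕ → Bool) (n : ℕ) :
    ∏ i ∈ Finset.range n, D.ratio i (ω i) ≤ ∏ i ∈ Finset.range n, D.long i :=
  Finset.prod_le_prod (fun i _ => (D.ratio_pos i _).le) fun i _ => D.ratio_le_long i _

/-- The non-autonomous IFS on `[0, 1]` with the given ratios. -/
noncomputable def toIFS : NonautonomousIFS ℝ where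
  J _ := Bool
  fintypeJ _ := inferInstance
  two_le_card _ := by simp
  ratio := D.ratio
  ratio_pos := D.ratio_pos
  ratio_lt_one n j := (D.ratio_le_long n j).trans_lt (D.long_lt_one n)
  orth _ _ := LinearIsometryEquiv.refl ℝ ℝ
  trans := D.trans
  X := Set.Icc 0 1
  nonempty_X := ⟨0, by simp⟩
  isCompact_X := isCompact_Icc
  mapsTo_X n j x hx := by
    have h1 := D.ratio_pos n j
    have h2 := D.trans_nonneg n j
    have h3 := D.trans_add_ratio_le n j
    simp only [LinearIsometryEquiv.coe_refl, id_eq, smul_eq_mul, Set.mem_Icc] at hx ⊢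
    constructor <;> nlinarith [hx.1, hx.2]
  tendsto_iSup_ratio :=
    squeeze_zero (fun n => Real.iSup_nonneg fun ω => Finset.prod_nonneg fun i _ =>
      (D.ratio_pos i _).le) (fun n => ciSup_le fun ω => D.prod_ratio_le ω n) D.tendsto_prod_long

theorem toIFS_map (n : ℕ) (j : Bool) (x : ℝ) :
    D.toIFS.map n j x = D.ratio n j * x + D.trans n j := rfl

theorem not_homogeneous : ¬ D.toIFS.Homogeneous := fun h => by
  obtain ⟨r, hr⟩ := h 0
  have h1 : D.short 0 = r := hr true
  have h2 : D.long 0 = r := hr false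
  linarith [D.short_lt_long 0]

theorem openSetCondition : D.toIFS.OpenSetCondition := by
  have hint : interior D.toIFS.X = Set.Ioo 0 1 := interior_Icc
  have key : ∀ n, ∀ x ∈ Set.Ioo (0 : ℝ) 1, ∀ y ∈ Set.Ioo (0 : ℝ) 1,
      D.toIFS.map n false x ≠ D.toIFS.map n true y := fun n x hx y hy h => by
    simp only [toIFS_map, ratio, trans, if_true, Bool.false_eq_true, if_false] at h
    have := D.long_add_short_le n
    nlinarith [D.long_pos n, D.short_pos n, hx.2, hy.1,
      mul_pos (D.long_pos n) (sub_pos.mpr hx.2), mul_pos (D.short_pos n) hy.1]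
  refine ⟨⟨1 / 2, by rw [hint]; norm_num⟩, fun n j j' hj => ?_⟩
  rw [hint, Set.eq_empty_iff_forall_notMem]
  rintro _ ⟨⟨x, hx, rfl⟩, y, hy, hxy⟩
  match j, j', hj with
  | false, false, hj => exact hj rfl
  | true, true, hj => exact hj rfl
  | false, true, _ => exact key n x hx y hy hxy.symm
  | true, false, _ => exact key n y hy x hx hxy

theorem coneCondition : D.toIFS.ConeCondition := by
  have hint : interior D.toIFS.X = Set.Ioo 0 1 := interior_Icc
  have hX : D.toIFS.X = Set.Icc 0 1 := rfl
  refine lt_of_lt_of_le (b := ENNReal.ofReal (1 / 2)) (by simp) ?_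
  refine le_iInf₂ fun x hx => le_iInf₂ fun r hr => ?_
  rw [hX] at hx
  -- The interval of length `r / 2` that starts at `x` towards the midpoint lies in `(0, 1)`.
  have hvol : ENNReal.ofReal (r * (1 / 2)) ≤
      volume (Metric.closedBall x r ∩ interior D.toIFS.X) := by
    rw [hint, Real.closedBall_eq_Icc]
    rcases le_total x (1 / 2) with h | h
    · calc ENNReal.ofReal (r * (1 / 2)) = volume (Set.Ioo x (x + r / 2)) := by
            rw [Real.volume_Ioo]; congr 1; ring
        _ ≤ _ := measure_mono fun y hy => by
            obtain ⟨h1, h2⟩ := hy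
            obtain ⟨h3, h4⟩ := hr
            exact ⟨⟨by linarith, by linarith⟩, by linarith [hx.1], by linarith⟩
    · calc ENNReal.ofReal (r * (1 / 2)) = volume (Set.Ioo (x - r / 2) x) := by
            rw [Real.volume_Ioo]; congr 1; ring
        _ ≤ _ := measure_mono fun y hy => by
            obtain ⟨h1, h2⟩ := hy
            obtain ⟨h3, h4⟩ := hr
            exact ⟨⟨by linarith, by linarith⟩, by linarith, by linarith [hx.2]⟩
  have hr0 : ENNReal.ofReal r ≠ 0 := by simpa using hr.1
  rw [Module.finrank_self, pow_one]
  calc ENNReal.ofReal (1 / 2)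
      = (ENNReal.ofReal r)⁻¹ * ENNReal.ofReal (r * (1 / 2)) := by
        rw [ENNReal.ofReal_mul hr.1.le, ← mul_assoc,
          ENNReal.inv_mul_cancel hr0 ENNReal.ofReal_ne_top, one_mul]
    _ ≤ _ := by gcongr

/-! ### The zeros of the pressure -/

theorem pressure_eq (n m : ℕ) (t : ℝ) :
    D.toIFS.pressure n m t =
      1 / (m : ℝ) * Real.log (∏ k : Fin m, (D.long (n + k) ^ t + D.short (n + k) ^ t)) := by
  have h : ∀ k : Fin m, D.long (n + k) ^ t + D.short (n + k) ^ t
      = ∑ j : Bool, D.ratio (n + k) j ^ t := fun k => by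
    simp [ratio, add_comm]
  simp only [h]
  rw [Fintype.prod_sum]
  rfl

theorem theta_pos (n m : ℕ) (hm : 0 < m) : 0 < D.toIFS.theta n m hm := by
  by_contra! hθ
  have h := D.toIFS.pressure_theta n m hm
  rw [pressure_eq] at h
  refine (mul_pos (a := 1 / (m : ℝ)) (by positivity) (Real.log_pos ?_)).ne' h
  have : (1 : ℝ) = ∏ _k : Fin m, 1 := by simp
  rw [this]
  refine Finset.prod_lt_prod_of_nonempty (by simp) (fun k _ => ?_) ⟨⟨0, hm⟩, Finset.mem_univ _⟩
  have h1 := Real.one_le_rpow_of_pos_of_le_one_of_nonpos (D.long_pos (n + k))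
    (D.long_lt_one (n + k)).le hθ
  have h2 := Real.rpow_pos_of_pos (D.short_pos (n + k)) (D.toIFS.theta n m hm)
  linarith

theorem theta_le {ε : ℝ} (hε : ∀ n, D.long n ^ ε + D.short n ^ ε ≤ 1) (n m : ℕ) (hm : 0 < m) :
    D.toIFS.theta n m hm ≤ ε := by
  by_contra! hθ
  have h := D.toIFS.pressure_theta n m hm
  rw [pressure_eq] at h
  have hpos : ∀ k : Fin m, 0 < D.long (n + k) ^ D.toIFS.theta n m hm +
      D.short (n + k) ^ D.toIFS.theta n m hm := fun k =>
    add_pos (Real.rpow_pos_of_pos (D.long_pos _) _) (Real.rpow_pos_of_pos (D.short_pos _) _)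
  refine (mul_neg_of_pos_of_neg (a := 1 / (m : ℝ)) (by positivity)
    (Real.log_neg (Finset.prod_pos fun k _ => hpos k) ?_)).ne h
  have : (1 : ℝ) = ∏ _k : Fin m, 1 := by simp
  rw [this]
  refine Finset.prod_lt_prod_of_nonempty (fun k _ => hpos k) (fun k _ => ?_)
    ⟨⟨0, hm⟩, Finset.mem_univ _⟩
  have h1 := Real.rpow_lt_rpow_of_exponent_gt (D.long_pos (n + k)) (D.long_lt_one (n + k)) hθ
  have h2 := Real.rpow_lt_rpow_of_exponent_gt (D.short_pos (n + k))
    ((D.short_lt_long (n + k)).trans (D.long_lt_one (n + k))) hθ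
  linarith [hε (n + k)]

/-! ### The neighbourhood count -/

theorem rho_succ (ω : ℕ → Bool) (n : ℕ) :
    D.toIFS.rho ω (n + 1) = D.toIFS.rho ω n * D.ratio n (ω n) := Finset.prod_range_succ _ _

theorem rho_antitone (ω : ℕ → Bool) : Antitone (D.toIFS.rho ω) :=
  antitone_nat_of_succ_le fun n => by
    rw [rho_succ]
    exact mul_le_of_le_one_right (D.toIFS.rho_pos ω n).le
      ((D.ratio_le_long n _).trans (D.long_lt_one n).le)

theorem comp_succ (ω : ℕ → Bool) (n : ℕ) (x : ℝ) : D.toIFS.comp ω (n + 1) x =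
    D.toIFS.comp ω n (D.ratio n (ω n) * x + D.trans n (ω n)) := rfl

theorem comp_eq (ω : ℕ → Bool) (n : ℕ) (x : ℝ) :
    D.toIFS.comp ω n x = D.toIFS.comp ω n 0 + D.toIFS.rho ω n * x := by
  induction n generalizing x with
  | zero => simp [comp, rho]
  | succ n ih =>
    simp only [comp_succ]
    rw [ih (D.ratio n (ω n) * x + _), ih (D.ratio n (ω n) * 0 + _), rho_succ]
    ring

theorem comp_succ_zero (ω : ℕ → Bool) (n : ℕ) :
    D.toIFS.comp ω (n + 1) 0 = D.toIFS.comp ω n 0 + D.toIFS.rho ω n * D.trans n (ω n) := by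
  rw [comp_succ, mul_zero, zero_add, comp_eq]

theorem comp_congr {ω ω' : ℕ → Bool} {n : ℕ} (h : ∀ i < n, ω' i = ω i) :
    D.toIFS.comp ω' n = D.toIFS.comp ω n := by
  induction n with
  | zero => rfl
  | succ n ih =>
    funext x
    rw [comp_succ, comp_succ, ih fun i hi => h i (by omega), h n (by omega)]

theorem rho_congr {ω ω' : ℕ → Bool} {n : ℕ} (h : ∀ i < n, ω' i = ω i) :
    D.toIFS.rho ω' n = D.toIFS.rho ω n :=
  Finset.prod_congr rfl fun i hi => by rw [h i (Finset.mem_range.mp hi)]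

/-- The left end of the cell of the cylinder `[ω 0, …, ω n]`. The cells of the two children of
a cylinder `Q` split the interval of `Q` at the right end of its long child, so that the cell of
the short child includes the gap between the children. -/
noncomputable def cellLeft (ω : ℕ → Bool) (n : ℕ) : ℝ :=
  D.toIFS.comp ω n 0 + D.toIFS.rho ω n * if ω n then D.long n else 0

/-- The right end of the cell of the cylinder `[ω 0, …, ω n]`, see `cellLeft`. -/
noncomputable def cellRight (ω : ℕ → Bool) (n : ℕ) : ℝ :=
  D.toIFS.comp ω n 0 + D.toIFS.rho ω n * if ω n then 1 else D.long n

theorem cellLeft_le_comp (ω : ℕ → Bool) (n : ℕ) :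
    D.cellLeft ω n ≤ D.toIFS.comp ω (n + 1) 0 := by
  rw [comp_succ_zero, cellLeft]
  have := D.toIFS.rho_pos ω n
  gcongr
  have := D.long_add_short_le n
  cases ω n <;> simp [trans]
  linarith

theorem comp_le_cellRight (ω : ℕ → Bool) (n : ℕ) :
    D.toIFS.comp ω (n + 1) 0 + D.toIFS.rho ω (n + 1) ≤ D.cellRight ω n := by
  rw [comp_succ_zero, cellRight, rho_succ, add_assoc, ← mul_add]
  have := D.toIFS.rho_pos ω n
  gcongr
  cases ω n <;> simp [trans, ratio]

theorem cellLeft_monotone (ω : ℕ → Bool) : Monotone (D.cellLeft ω) :=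
  monotone_nat_of_le_succ fun n => (D.cellLeft_le_comp ω n).trans <|
    le_add_of_nonneg_right <| mul_nonneg (D.toIFS.rho_pos ω _).le <| by
      have := D.long_pos (n + 1)
      split_ifs <;> linarith

theorem cellRight_antitone (ω : ℕ → Bool) : Antitone (D.cellRight ω) :=
  antitone_nat_of_succ_le fun n => le_trans (by
    rw [cellRight]
    gcongr
    refine mul_le_of_le_one_right (D.toIFS.rho_pos ω _).le ?_
    have := D.long_lt_one (n + 1)
    split_ifs <;> linarith) (D.comp_le_cellRight ω n)

theorem cellLeft_add_le (ω : ℕ → Bool) (n : ℕ) :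
    D.cellLeft ω n + D.toIFS.rho ω n * (1 - D.long n) ≤ D.cellRight ω n := by
  rw [cellRight, cellLeft, add_assoc, ← mul_add]
  have := D.toIFS.rho_pos ω n
  have := D.half_lt_long n
  gcongr
  split_ifs <;> linarith

/-- Distinct cylinders of the same size have disjoint cells: look at the first letter where
their words differ. -/
theorem cells_disjoint {r : ℝ} {ω ω' : ℕ → Bool} {n n' : ℕ}
    (h1 : D.toIFS.rho ω (n + 1) ≤ r) (h2 : r < D.toIFS.rho ω n)
    (h1' : D.toIFS.rho ω' (n' + 1) ≤ r) (h2' : r < D.toIFS.rho ω' n')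
    (hne : D.toIFS.cyl ω (n + 1) ≠ D.toIFS.cyl ω' (n' + 1)) :
    D.cellRight ω n ≤ D.cellLeft ω' n' ∨ D.cellRight ω' n' ≤ D.cellLeft ω n := by
  -- A word cannot extend another one of the same size.
  have hlt : ∀ {σ τ : ℕ → Bool} {k l : ℕ}, D.toIFS.rho σ (k + 1) ≤ r → r < D.toIFS.rho τ l →
      (∀ i < k + 1, τ i = σ i) → l ≤ k := fun {σ τ k l} hσ hτ h => by
    by_contra! hkl
    have := D.rho_antitone τ (show k + 1 ≤ l by omega)
    rw [D.rho_congr h] at this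
    linarith
  have hex : ∃ i, i ≤ n ∧ i ≤ n' ∧ ω i ≠ ω' i := by
    by_contra! hall
    have hn : n = n' := by
      rcases le_total n n' with h | h
      · exact h.antisymm (hlt h1 h2' fun i hi => (hall i (by omega) (by omega)).symm)
      · exact (h.antisymm (hlt h1' h2 fun i hi => hall i (by omega) (by omega))).symm
    subst hn
    refine hne (Set.ext fun σ => forall₂_congr fun i hi => ?_)
    rw [hall i (by omega) (by omega)]
  classical
  obtain ⟨hi, hi', hd⟩ := Nat.find_spec hex
  have hagree : ∀ k < Nat.find hex, ω' k = ω k := fun k hk => by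
    by_contra hk'
    exact Nat.find_min hex hk ⟨by omega, by omega, Ne.symm hk'⟩
  set i := Nat.find hex
  have e1 := D.cellRight_antitone ω hi
  have e2 := D.cellRight_antitone ω' hi'
  have e3 := D.cellLeft_monotone ω hi
  have e4 := D.cellLeft_monotone ω' hi'
  have hc := D.comp_congr hagree
  have hr := D.rho_congr hagree
  cases hω : ω i with
  | false =>
    have hω' : ω' i = true := by simpa [hω] using hd.symm
    refine Or.inl (e1.trans (le_trans (le_of_eq ?_) e4))
    simp [cellRight, cellLeft, hω, hω', hc, hr]
  | true =>
    have hω' : ω' i = false := by simpa [hω] using hd.symm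
    refine Or.inr (e2.trans (le_trans (le_of_eq ?_) e3))
    simp [cellRight, cellLeft, hω, hω', hc, hr]

/-- The cells of the cylinders of size `r` are disjoint, and have length at least `r / k` if the
short children of the parents, together with the gaps next to them, take up the proportion `1 / k`
at least. -/
theorem neighbourhoodCount_le {r : ℝ} (hr : 0 < r) {k : ℕ} (hk : 0 < k)
    (h : ∀ (ω : ℕ → Bool) (n : ℕ), r < D.toIFS.rho ω n → 1 / (k : ℝ) ≤ 1 - D.long n) :
    D.toIFS.neighbourhoodCount r ≤ (2 * k + 2 : ℕ) := by
  refine iSup₂_le fun x _ => ?_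
  have hex : ∀ Q : Set D.toIFS.Δ, ∃ p : (ℕ → Bool) × ℕ, Q ∈ D.toIFS.cylindersOfSize r →
      Q = D.toIFS.cyl p.1 (p.2 + 1) ∧ D.toIFS.rho p.1 (p.2 + 1) ≤ r ∧ r < D.toIFS.rho p.1 p.2 :=
    fun Q => by
      by_cases hQ : Q ∈ D.toIFS.cylindersOfSize r
      · obtain ⟨ω, n, hn⟩ := hQ
        exact ⟨(ω, n), fun _ => hn⟩
      · exact ⟨(fun _ => true, 0), fun h => absurd h hQ⟩
  choose p hp using hex
  have hk' : (0 : ℝ) < k := by exact_mod_cast hk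
  -- The cell of `Q` includes the point of `B(x, r)` coded by a word in `Q`.
  have hmeet : ∀ Q ∈ D.toIFS.neighbourhood x r, ∃ y ∈ Metric.closedBall x r,
      D.cellLeft (p Q).1 (p Q).2 ≤ y ∧ y ≤ D.cellRight (p Q).1 (p Q).2 := fun Q hQ => by
    obtain ⟨_, ⟨ω, hω, rfl⟩, hball⟩ := hQ.2
    rw [(hp Q hQ.1).1] at hω
    refine ⟨_, hball, ?_⟩
    obtain ⟨t, ht, hte⟩ := D.toIFS.coding_mem ω ((p Q).2 + 1)
    have hρ := D.toIFS.rho_pos (p Q).1 ((p Q).2 + 1)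
    rw [D.comp_congr hω, comp_eq] at hte
    have ht0 : 0 ≤ t := ht.1
    have ht1 : t ≤ 1 := ht.2
    have e1 := D.cellLeft_le_comp (p Q).1 (p Q).2
    have e2 := D.comp_le_cellRight (p Q).1 (p Q).2
    rw [← hte]
    constructor <;> nlinarith
  refine encard_le_of_disjoint_intervals _ (fun Q => D.cellLeft (p Q).1 (p Q).2)
    (fun Q => D.cellRight (p Q).1 (p Q).2) (x - r) (x + r) (r / k) (2 * k) (by positivity)
    (by linarith) (le_of_eq (by push_cast; field_simp; ring)) (fun Q hQ => ?_) (fun Q hQ => ?_)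
    (fun Q hQ => ?_) (fun Q hQ Q' hQ' hne => ?_)
  · refine le_trans ?_ (D.cellLeft_add_le _ _)
    obtain ⟨-, -, h3⟩ := hp Q hQ.1
    rw [div_eq_mul_one_div]
    exact add_le_add_right
      (mul_le_mul h3.le (h _ _ h3) (by positivity) (D.toIFS.rho_pos _ _).le) _
  · obtain ⟨y, hy, -, h2⟩ := hmeet Q hQ
    rw [Real.closedBall_eq_Icc] at hy
    exact hy.1.trans h2
  · obtain ⟨y, hy, h1, -⟩ := hmeet Q hQ
    rw [Real.closedBall_eq_Icc] at hy
    exact h1.trans hy.2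
  · obtain ⟨h1, h2, h3⟩ := hp Q hQ.1
    obtain ⟨h1', h2', h3'⟩ := hp Q' hQ'.1
    exact D.cells_disjoint h2 h3 h2' h3' (h1 ▸ h1' ▸ hne)

end TwoMapRatios

/-! ### Assouad dimension of subsets of the line -/

/-- Every subset of the line has Assouad dimension at most `1`. -/
theorem assouadDim_le_one (K : Set ℝ) : assouadDim K ≤ 1 := by
  refine sInf_le ⟨1, ⟨3, by norm_num, fun r R hr hrR _ x _ => ?_⟩, by simp⟩
  have hq : 1 ≤ R / r := (one_le_div hr).mpr hrR
  -- Equally spaced centres `x - R + i * r`.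
  set c : ℕ → ℝ := fun i => x - R + i * r with hc
  set N := ⌊2 * R / r⌋₊ + 1 with hN
  set s : Finset ℝ := (Finset.range N).image c with hs
  have hcov : Metric.IsCover r.toNNReal (Metric.closedBall x R ∩ K) (s : Set ℝ) := by
    rintro y ⟨hy, -⟩
    rw [Real.closedBall_eq_Icc] at hy
    have h0 : 0 ≤ (y - (x - R)) / r := div_nonneg (by linarith [hy.1]) hr.le
    refine ⟨c ⌊(y - (x - R)) / r⌋₊, ?_, ?_⟩
    · refine Finset.mem_coe.mpr (Finset.mem_image_of_mem _ (Finset.mem_range.mpr ?_))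
      refine Nat.lt_succ_of_le (Nat.floor_le_floor ?_)
      gcongr
      linarith [hy.2]
    · have h1 := Nat.floor_le h0
      have h2 := (Nat.lt_floor_add_one ((y - (x - R)) / r)).le
      rw [le_div_iff₀ hr] at h1
      rw [div_le_iff₀ hr] at h2
      simp only [edist_dist, Set.mem_ofPred_eq]
      rw [ENNReal.ofReal_le_iff_le_toReal (by simp)]
      simp only [ENNReal.coe_toReal, Real.coe_toNNReal r hr.le, Real.dist_eq, hc]
      rw [abs_le]
      constructor <;> linarith
  have hcard : (Metric.externalCoveringNumber r.toNNReal (Metric.closedBall x R ∩ K)) ≤ N := by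
    refine (Metric.IsCover.externalCoveringNumber_le_encard hcov).trans ?_
    rw [Set.encard_coe_eq_coe_finsetCard]
    exact_mod_cast Finset.card_image_le.trans (Finset.card_range N).le
  calc (Metric.externalCoveringNumber r.toNNReal (Metric.closedBall x R ∩ K) : ℝ≥0∞)
      ≤ ((N : ℕ∞) : ℝ≥0∞) := by exact_mod_cast hcard
    _ = ENNReal.ofReal N := by simp
    _ ≤ ENNReal.ofReal (3 * (R / r) ^ (1 : ℝ)) := by
      refine ENNReal.ofReal_le_ofReal ?_
      have := Nat.floor_le (show 0 ≤ 2 * R / r by have := hr.trans_le hrR; positivity)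
      rw [Real.rpow_one, hN]
      push_cast
      linarith [mul_div_assoc 2 R r]

/-- If a set contains points in `[0, R]` which approximate all points of `(0, R]` up to `r`, then
at least `R / (4 * r)` balls of radius `r` are needed to cover its part in `[0, R]`. -/
theorem le_externalCoveringNumber {A : Set ℝ} {r R : ℝ} (hr : 0 < r)
    (hA : ∀ y ∈ Set.Ioc 0 R, ∃ a ∈ A, |a - y| ≤ r) :
    ENNReal.ofReal (R / (4 * r)) ≤
      (Metric.externalCoveringNumber r.toNNReal A : ℝ≥0∞) := by
  by_cases htop : Metric.externalCoveringNumber r.toNNReal A = ⊤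
  · simp [htop]
  obtain ⟨c, hfin, hcov, hcard⟩ : ∃ c : Set ℝ, c.Finite ∧ Metric.IsCover r.toNNReal A c ∧
      c.encard = Metric.externalCoveringNumber r.toNNReal A := by
    have : Nonempty {c : Set ℝ // Metric.IsCover r.toNNReal A c} := ⟨⟨A, by simp⟩⟩
    obtain ⟨⟨c, hc⟩, hcA⟩ := ENat.exists_eq_iInf
      fun c : {c : Set ℝ // Metric.IsCover r.toNNReal A c} => c.1.encard
    rw [iInf_subtype] at hcA
    refine ⟨c, ?_, hc, hcA⟩
    rw [← Set.encard_ne_top_iff]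
    exact fun h => htop (hcA.symm.trans h)
  lift c to Finset ℝ using hfin
  have hsub : Set.Ioc 0 R ⊆ ⋃ z ∈ c, Metric.closedBall z (2 * r) := fun y hy => by
    obtain ⟨a, ha, hay⟩ := hA y hy
    obtain ⟨z, hz, haz⟩ := hcov ha
    refine Set.mem_iUnion₂.mpr ⟨z, hz, ?_⟩
    have h1 : dist a z ≤ r := by
      have : edist a z ≤ ENNReal.ofReal r := haz
      rwa [edist_dist, ENNReal.ofReal_le_ofReal_iff hr.le] at this
    have h2 : dist y a ≤ r := by rwa [dist_comm, Real.dist_eq]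
    exact Metric.mem_closedBall.mpr (by linarith [dist_triangle y a z])
  have hvol : ENNReal.ofReal R ≤ c.card * ENNReal.ofReal (4 * r) := by
    calc ENNReal.ofReal R = volume (Set.Ioc 0 R) := by simp
      _ ≤ volume (⋃ z ∈ c, Metric.closedBall z (2 * r)) := measure_mono hsub
      _ ≤ ∑ z ∈ c, volume (Metric.closedBall z (2 * r)) := measure_biUnion_finset_le _ _
      _ = c.card * ENNReal.ofReal (4 * r) := by
        simp only [Real.volume_closedBall, Finset.sum_const, nsmul_eq_mul]
        ring_nf
  rw [← hcard, Set.encard_coe_eq_coe_finsetCard, ENNReal.ofReal_div_of_pos (by positivity)]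
  exact ENNReal.div_le_of_le_mul (by simpa using hvol)

/-- A set containing a decreasing sequence of positive numbers which tends to `0` more slowly than
every geometric sequence has Assouad dimension at least `1`. -/
theorem one_le_assouadDim_of_seq {K : Set ℝ} {u δ : ℕ → ℝ} (huK : ∀ n, u n ∈ K)
    (hupos : ∀ n, 0 < u n) (hu0 : Tendsto u atTop (𝓝 0)) (hδpos : ∀ n, 0 < δ n)
    (hδ1 : ∀ n, δ n ≤ 1)
    (hδ : Antitone δ) (hδ0 : Tendsto δ atTop (𝓝 0)) (hu : ∀ n, u (n + 1) = (1 - δ n) * u n) :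
    1 ≤ assouadDim K := by
  have hanti : Antitone u := antitone_nat_of_succ_le fun n => by
    rw [hu]
    nlinarith [hupos n, hδpos n]
  refine le_sInf ?_
  rintro _ ⟨s, ⟨C, hC, hcov⟩, rfl⟩
  by_contra! hs1
  have hs : s < 1 := by exact_mod_cast hs1
  -- Compare the scales `R = u k` and `r = δ k * u k`.
  have key : ∀ᶠ k in atTop, (δ k)⁻¹ ^ (1 - s) ≤ 4 * C := by
    filter_upwards [hu0.eventually (gt_mem_nhds one_pos)] with k hk
    have hk0 := hupos k
    have hd0 := hδpos k
    have hA : ∀ y ∈ Set.Ioc 0 (u k), ∃ a ∈ Metric.closedBall (u k) (u k) ∩ K,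
        |a - y| ≤ δ k * u k := fun y hy => by
      have hex : ∃ j, u (k + j + 1) < y := by
        obtain ⟨j, hj1, hj2⟩ := ((hu0.eventually (gt_mem_nhds hy.1)).and
          (eventually_ge_atTop (k + 1))).exists
        exact ⟨j - k - 1, by rwa [show k + (j - k - 1) + 1 = j by omega]⟩
      classical
      have h1 := Nat.find_spec hex
      have h2 : y ≤ u (k + Nat.find hex) := by
        rcases Nat.eq_zero_or_pos (Nat.find hex) with h | h
        · rw [h]; exact hy.2
        · have := Nat.find_min hex (Nat.sub_lt h one_pos)
          rw [show k + (Nat.find hex - 1) + 1 = k + Nat.find hex by omega] at this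
          exact not_lt.mp this
      set j := k + Nat.find hex
      have h3 : u j ≤ u k := hanti (by omega)
      have h4 : δ j ≤ δ k := hδ (by omega)
      have h5 := hupos j
      refine ⟨u j, ⟨?_, huK j⟩, ?_⟩
      · rw [Real.closedBall_eq_Icc]
        constructor <;> linarith
      · rw [hu] at h1
        rw [abs_of_nonneg (by linarith)]
        have : δ j * u j ≤ δ k * u k := mul_le_mul h4 h3 h5.le hd0.le
        linarith
    have h := (le_externalCoveringNumber (by positivity) hA).trans
      (hcov (δ k * u k) (u k) (by positivity) (mul_le_of_le_one_left hk0.le (hδ1 k)) hk _ (huK k))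
    rw [show u k / (δ k * u k) = (δ k)⁻¹ by field_simp,
      ENNReal.ofReal_le_ofReal_iff (by positivity),
      show u k / (4 * (δ k * u k)) = (δ k)⁻¹ / 4 by field_simp] at h
    rw [Real.rpow_sub (by positivity), Real.rpow_one, div_le_iff₀ (by positivity)]
    linarith
  have hinv : Tendsto (fun k => (δ k)⁻¹) atTop atTop :=
    (tendsto_nhdsWithin_iff.mpr ⟨hδ0, Eventually.of_forall hδpos⟩).inv_tendsto_nhdsGT_zero
  have hlim := (tendsto_rpow_atTop (show 0 < 1 - s by linarith)).comp hinv
  obtain ⟨k, hk1, hk2⟩ := (key.and (hlim.eventually_gt_atTop (4 * C))).exists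
  exact absurd hk1 (not_le.mpr hk2)

/-! ### The limit set of a two-map system -/

namespace TwoMapRatios

variable (D : TwoMapRatios)

/-- The points coded by `k` long letters followed by short letters only. -/
theorem prod_long_mem_limitSet (k : ℕ) :
    ∏ i ∈ Finset.range k, D.long i ∈ D.toIFS.limitSet := by
  set ω : ℕ → Bool := fun i => decide (k ≤ i) with hω
  have h1 : ∀ n, D.toIFS.comp ω (k + n) 1 = ∏ i ∈ Finset.range k, D.long i := fun n => by
    induction n with
    | zero =>
      have hzero : ∀ m ≤ k, D.toIFS.comp ω m 0 = 0 ∧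
          D.toIFS.rho ω m = ∏ i ∈ Finset.range m, D.long i := fun m hm => by
        induction m with
        | zero => simp [comp, rho]
        | succ m ih =>
          obtain ⟨e1, e2⟩ := ih (by omega)
          have hm' : ω m = false := by simp [hω]; omega
          rw [comp_succ_zero, rho_succ, e1, e2, hm', Finset.prod_range_succ]
          simp [trans, ratio]
      rw [add_zero, comp_eq, (hzero k le_rfl).1, (hzero k le_rfl).2]
      ring
    | succ n ih =>
      have hn : ω (k + n) = true := by simp [hω]
      rw [← add_assoc, comp_succ, hn, ← ih]
      simp [ratio, trans]
  have hsub : ∀ n m, D.toIFS.comp ω (n + m) '' D.toIFS.X ⊆ D.toIFS.comp ω n '' D.toIFS.X :=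
    fun n m => by
      induction m with
      | zero => exact subset_rfl
      | succ m ih =>
        refine Set.Subset.trans ?_ ih
        rintro _ ⟨y, hy, rfl⟩
        exact ⟨_, D.toIFS.mapsTo_X (n + m) (ω (n + m)) hy, rfl⟩
  refine Set.mem_iInter.mpr fun n =>
    Set.mem_iUnion.mpr ⟨ω, hsub n k ⟨1, ⟨zero_le_one, le_rfl⟩, ?_⟩⟩
  rw [add_comm, h1]

theorem assouadDim_limitSet (hmono : Monotone D.long) (hlim : Tendsto D.long atTop (𝓝 1)) :
    assouadDim D.toIFS.limitSet = 1 := by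
  refine le_antisymm (assouadDim_le_one _) (one_le_assouadDim_of_seq
    (u := fun k => ∏ i ∈ Finset.range k, D.long i) (δ := fun k => 1 - D.long k)
    D.prod_long_mem_limitSet (fun k => Finset.prod_pos fun i _ => D.long_pos i)
    D.tendsto_prod_long (fun k => sub_pos.mpr (D.long_lt_one k))
    (fun k => by linarith [D.long_pos k])
    (fun i j hij => sub_le_sub_left (hmono hij) 1) ?_ (fun k => ?_))
  · simpa using hlim.const_sub 1
  · rw [Finset.prod_range_succ]
    ring

end TwoMapRatios

/-! ### Choice of the ratios -/

/-- With `h n ≤ n`, the product of the ratios `1 - 1 / (h n + 3)` is at most the telescoping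
product of the `1 - 1 / (n + 3)`. -/
theorem prod_one_sub_le {h : ℕ → ℕ} (hle : ∀ n, h n ≤ n) (n : ℕ) :
    ∏ i ∈ Finset.range n, (1 - 1 / (h i + 3 : ℝ)) ≤ 2 / (n + 2) := by
  induction n with
  | zero => simp
  | succ n ih =>
    have h1 : (h n : ℝ) ≤ n := by exact_mod_cast hle n
    have h2 : (1 : ℝ) / (n + 3) ≤ 1 / (h n + 3) := by gcongr
    have h3 : (1 : ℝ) / (h n + 3) ≤ 1 / 3 := by gcongr; simp
    rw [Finset.prod_range_succ]
    calc _ ≤ 2 / (n + 2 : ℝ) * (1 - 1 / (n + 3 : ℝ)) :=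
          mul_le_mul ih (by linarith) (by linarith) (by positivity)
      _ = 2 / ((n + 1 : ℕ) + 2 : ℝ) := by
        push_cast
        field_simp
        ring

/-- The ratios `1 - 1 / (h n + 3)`, and short ratios so small that at each level the sum of the
`ε`-th powers of the ratios is at most `1`. -/
noncomputable def slowRatios (h : ℕ → ℕ) (hle : ∀ n, h n ≤ n) (ε : ℝ) (hε : 0 < ε) :
    TwoMapRatios where
  long n := 1 - 1 / (h n + 3 : ℝ)
  short n := min (1 / (h n + 3 : ℝ)) ((1 - (1 - 1 / (h n + 3 : ℝ)) ^ ε) ^ ε⁻¹)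
  half_lt_long n := by
    have : (1 : ℝ) / (h n + 3) ≤ 1 / 3 := by gcongr; simp
    linarith
  short_pos n := by
    have h1 : (1 : ℝ) / (h n + 3) ≤ 1 / 3 := by gcongr; simp
    have h2 : 0 < (1 : ℝ) / (h n + 3) := by positivity
    have := Real.rpow_lt_one (x := 1 - 1 / (h n + 3 : ℝ)) (by linarith) (by linarith) hε
    exact lt_min h2 (Real.rpow_pos_of_pos (by linarith) _)
  long_add_short_le n := by
    linarith [min_le_left (1 / (h n + 3 : ℝ)) ((1 - (1 - 1 / (h n + 3 : ℝ)) ^ ε) ^ ε⁻¹)]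
  tendsto_prod_long := by
    refine squeeze_zero (fun n => Finset.prod_nonneg fun i _ => ?_) (prod_one_sub_le hle) ?_
    · have : (1 : ℝ) / (h i + 3) ≤ 1 / 3 := by gcongr; simp
      linarith
    · exact tendsto_const_nhds.div_atTop
        (tendsto_natCast_atTop_atTop.atTop_add tendsto_const_nhds)

section

variable {h : ℕ → ℕ} (hle : ∀ n, h n ≤ n) {ε : ℝ} (hε : 0 < ε)

theorem slowRatios_long (n : ℕ) : (slowRatios h hle ε hε).long n = 1 - 1 / (h n + 3 : ℝ) := rfl

theorem slowRatios_rpow_add_le (n : ℕ) :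
    (slowRatios h hle ε hε).long n ^ ε + (slowRatios h hle ε hε).short n ^ ε ≤ 1 := by
  have h1 := (slowRatios h hle ε hε).long_pos n
  have h2 := Real.rpow_le_one h1.le ((slowRatios h hle ε hε).long_lt_one n).le hε.le
  have h3 : (slowRatios h hle ε hε).short n ≤
      (1 - (slowRatios h hle ε hε).long n ^ ε) ^ ε⁻¹ := min_le_right _ _
  have h4 := Real.rpow_le_rpow ((slowRatios h hle ε hε).short_pos n).le h3 hε.le
  rw [Real.rpow_inv_rpow (by linarith) hε.ne'] at h4
  linarith

/-- Cylinders of size `r` have parents at levels at most `N`, if `2 / (n + 2) ≤ r` beyond `N`. -/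
theorem slowRatios_neighbourhoodCount_le (hmono : Monotone h) {r : ℝ} (hr : 0 < r) {N : ℕ}
    (hN : ∀ n : ℕ, r < 2 / (n + 2 : ℝ) → n ≤ N) :
    (slowRatios h hle ε hε).toIFS.neighbourhoodCount r ≤ (2 * h N + 8 : ℕ) := by
  refine (TwoMapRatios.neighbourhoodCount_le _ hr (k := h N + 3) (by omega)
    fun ω n hn => ?_).trans (by norm_cast)
  have h1 : n ≤ N := hN n <| hn.trans_le <|
    ((slowRatios h hle ε hε).prod_ratio_le ω n).trans (prod_one_sub_le hle n)
  have h2 : (h n : ℝ) ≤ h N := by exact_mod_cast hmono h1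
  rw [slowRatios_long, sub_sub_cancel]
  push_cast
  gcongr

theorem slowRatios_assouadDim (hmono : Monotone h) (hlim : Tendsto h atTop atTop) :
    assouadDim (slowRatios h hle ε hε).toIFS.limitSet = 1 := by
  refine TwoMapRatios.assouadDim_limitSet _ (fun m n hmn => ?_) ?_
  · have : (h m : ℝ) ≤ h n := by exact_mod_cast hmono hmn
    simp only [slowRatios_long]
    gcongr
  · have h1 : Tendsto (fun n => 1 / (h n + 3 : ℝ)) atTop (𝓝 0) :=
      tendsto_const_nhds.div_atTop
        ((tendsto_natCast_atTop_atTop.comp hlim).atTop_add tendsto_const_nhds)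
    simpa only [sub_zero, ← slowRatios_long hle hε] using h1.const_sub 1

end

/-- The sequence `h` tends to infinity so slowly that `f` stays above `2 * h n + 8` on
`(0, 2 / (n + 2)]` for all large `n`: take the largest `k ≤ n` for which `f` is at least
`2 * k + 8` there. -/
theorem exists_slow_sequence (f : ℝ → ℝ) (hf : Tendsto f (𝓝[>] 0) atTop) :
    ∃ h : ℕ → ℕ, Monotone h ∧ (∀ n, h n ≤ n) ∧ Tendsto h atTop atTop ∧
      ∀ᶠ n : ℕ in atTop, ∀ r : ℝ, 0 < r → r ≤ 2 / (n + 2) → (2 * h n + 8 : ℝ) ≤ f r := by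
  classical
  set P : ℕ → ℕ → Prop := fun n k =>
    ∀ r : ℝ, 0 < r → r ≤ 2 / (n + 2) → (2 * k + 8 : ℝ) ≤ f r with hP
  have hev : ∀ k, ∀ᶠ n in atTop, P n k := fun k => by
    obtain ⟨c, hc, hfc⟩ := mem_nhdsGT_iff_exists_Ioo_subset.mp
      (hf.eventually_ge_atTop (2 * k + 8 : ℝ))
    have hlim : Tendsto (fun n : ℕ => 2 / (n + 2 : ℝ)) atTop (𝓝 0) :=
      tendsto_const_nhds.div_atTop
        (tendsto_natCast_atTop_atTop.atTop_add tendsto_const_nhds)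
    filter_upwards [hlim.eventually (gt_mem_nhds (Set.mem_Ioi.mp hc))] with n hn r hr hrn
    exact hfc ⟨hr, hrn.trans_lt hn⟩
  have hPmono : ∀ k {m n : ℕ}, m ≤ n → P m k → P n k := fun k m n hmn hm r hr hrn => by
    refine hm r hr (hrn.trans ?_)
    have : (m : ℝ) ≤ n := by exact_mod_cast hmn
    gcongr
  refine ⟨fun n => Nat.findGreatest (P n) n, fun m n hmn => ?_, fun n => Nat.findGreatest_le n,
    tendsto_atTop.mpr fun k => ?_, ?_⟩
  · exact Nat.findGreatest_mono (fun k => hPmono k hmn) hmn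
  · filter_upwards [hev k, eventually_ge_atTop k] with n hn hkn
    exact Nat.le_findGreatest hkn hn
  · filter_upwards [hev 0] with n hn
    exact Nat.findGreatest_spec (P := P n) (Nat.zero_le n) hn

theorem mainTheorem9 (ε : ℝ) (hε : 0 < ε) (f : ℝ → ℝ) (hf : Tendsto f (𝓝[>] 0) atTop) :
    ∃ Φ : NonautonomousIFS ℝ,
      Φ.X = Set.Icc 0 1 ∧
      ¬ Φ.Homogeneous ∧
      Φ.OpenSetCondition ∧
      Φ.ConeCondition ∧
      (∀ᶠ r in 𝓝[>] (0 : ℝ), ((Φ.neighbourhoodCount r : ℝ≥0∞) : EReal) ≤ (f r : EReal)) ∧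
      (∀ n, Fintype.card (Φ.J n) = 2) ∧
      assouadDim Φ.limitSet = 1 ∧
      ∀ (n m : ℕ) (hm : 0 < m), 0 < Φ.theta n m hm ∧ Φ.theta n m hm ≤ ε := by
  obtain ⟨h, hmono, hle, hlim, hslow⟩ := exists_slow_sequence f hf
  refine ⟨(slowRatios h hle ε hε).toIFS, rfl, TwoMapRatios.not_homogeneous _,
    TwoMapRatios.openSetCondition _, TwoMapRatios.coneCondition _, ?_, fun n => Fintype.card_bool,
    slowRatios_assouadDim hle hε hmono hlim, fun n m hm => ⟨TwoMapRatios.theta_pos _ n m hm,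
      TwoMapRatios.theta_le _ (slowRatios_rpow_add_le hle hε) n m hm⟩⟩
  obtain ⟨N₀, hN₀⟩ := eventually_atTop.mp hslow
  filter_upwards [Ioo_mem_nhdsGT (show (0 : ℝ) < 2 / (N₀ + 2) by positivity)] with r ⟨hr, hr0⟩
  -- `N` is the last level with `r ≤ 2 / (N + 2)`.
  obtain ⟨N, hN⟩ : ∃ N, ⌊2 / r⌋₊ = N + 2 := by
    refine Nat.exists_eq_add_of_le' (Nat.le_floor ?_)
    rw [le_div_iff₀ hr]
    have : (2 : ℝ) / (N₀ + 2) ≤ 2 / 2 := by gcongr; simp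
    push_cast
    linarith
  have hlast : ∀ n : ℕ, r < 2 / (n + 2 : ℝ) → n ≤ N := fun n hn => by
    have : n + 2 ≤ ⌊2 / r⌋₊ := Nat.le_floor <| by
      rw [lt_div_iff₀ (by positivity)] at hn
      rw [le_div_iff₀ hr]
      push_cast
      linarith
    omega
  have hrN : r ≤ 2 / (N + 2) := by
    have := Nat.floor_le (show 0 ≤ 2 / r by positivity)
    rw [hN, le_div_iff₀ hr] at this
    rw [le_div_iff₀ (by positivity)]
    push_cast at this
    linarith
  have hcount := slowRatios_neighbourhoodCount_le hle hε hmono hr hlast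
  have hfr := hN₀ N (hlast N₀ hr0) r hr hrN
  calc (((slowRatios h hle ε hε).toIFS.neighbourhoodCount r : ℝ≥0∞) : EReal)
      ≤ (((2 * h N + 8 : ℕ) : ℝ≥0∞) : EReal) := by exact_mod_cast hcount
    _ = ((2 * h N + 8 : ℝ) : EReal) := by norm_cast
    _ ≤ (f r : EReal) := by exact_mod_cast hfr
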